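/- **(Polyhedral inapproximability of CLIQUE)** Let $n$ be a positive integer and write $[n]=\{1,\dots,n\}$. Encode CLIQUE in dimension $n^2$ as a maximization problem over $\mathbb{R}^{n\times n}$ as follows. The feasible solutions are the matrices $bb^{\intercal}$ with $b\in\{0,1\}^n$, so that the inner polytope is the correlation polytope $P=\mathrm{COR}(n)=\mathrm{conv}\{bb^{\intercal} : b\in\{0,1\}^n\}$. The admissible objective functions are the matrices $w^G$, for all graphs $G$ with $V(G)\subseteq[n]$, where $w^G_{ii}=1$ if $i\in V(G)$ and $w^G_{ii}=0$ otherwise, and, for $i\ne j$, $w^G_{ij}=-1$ if $i,j\in V(G)$ and $ij\notin E(G)$, and $w^G_{ij}=0$ otherwise. For $\rho\ge 1$, a *$\rho$-approximate extended formulation* of size $r$ is a finite linear system $Ex+Fy=g$, $y\ge 0$ with $x\in\mathbb{R}^{n\times n}$ and $y\in\mathbb{R}^r$ such that, with $\langle\cdot,\cdot\rangle$ the Frobenius inner product, $$\max\{\langle w,x\rangle : Ex+Fy=g,\ y\ge 0\}\ \ge\ \max\{\langle w,x\rangle : x\in P\}\quad\text{for all } w\in\mathbb{R}^{n\times n},$$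 $$\max\{\langle w^G,x\rangle : Ex+Fy=g,\ y\ge 0\}\ \le\ \rho\,\max\{\langle w^G,x\rangle : x\in P\}\quad\text{for all graphs } G \text{ with } V(G)\subseteq[n]$$ (a maximum is $+\infty$ if unbounded and $-\infty$ if the system is infeasible). Then CLIQUE has an $n$-approximate extended formulation of size $O(n^2)$: there is a constant $C$ such that for every $n\ge 1$ there is one of size at most $Cn^2$. Moreover, for every $0<\epsilon<1/2$, every $n^{1/2-\epsilon}$-approximate extended formulation of CLIQUE has size $2^{\Omega(n^{2\epsilon})}$: there are $c>0$ and $N$, depending only on $\epsilon$, such that for all $n\ge N$ every $n^{1/2-\epsilon}$-approximate extended formulation has size at least $2^{c\,n^{2\epsilon}}$. -/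

import Mathlib

open scoped Matrix

noncomputable section

/-- A linear encoding of a combinatorial optimization problem in a fixed dimension, with
coordinates indexed by `ι`: a set of 0/1 feasible solutions and a set of admissible objective
functions. -/
structure LinearEncoding (ι : Type*) where
  feasible : Set (ι → ℝ)
  zero_or_one : ∀ x ∈ feasible, ∀ i, x i = 0 ∨ x i = 1
  admissible : Set (ι → ℝ)

/-- The inner polytope `P` of a linear encoding: the convex hull of the feasible solutions. -/
def LinearEncoding.innerPolytope {ι : Type*} (L : LinearEncoding ι) : Set (ι → ℝ) :=
  convexHull ℝ L.feasible

/-- A linear system `E x + F y = g, y ≥ 0` with `x ∈ ℝ^ι` and `y ∈ ℝ^size`. Its size is the number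
of the inequalities `y ≥ 0`; the number of equations is finite and otherwise arbitrary. -/
structure ExtendedFormulation (ι : Type*) where
  numEq : ℕ
  size : ℕ
  E : Matrix (Fin numEq) ι ℝ
  F : Matrix (Fin numEq) (Fin size) ℝ
  g : Fin numEq → ℝ

/-- The set of all `x` that extend to a solution `(x, y)` of the system. -/
def ExtendedFormulation.projection {ι : Type*} [Fintype ι] (S : ExtendedFormulation ι) :
    Set (ι → ℝ) :=
  {x | ∃ y : Fin S.size → ℝ, (∀ k, 0 ≤ y k) ∧ S.E *ᵥ x + S.F *ᵥ y = S.g}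

/-- The value of `max {w ⬝ x | x ∈ K}`, as an extended real
(`⊤` if unbounded, `⊥` if `K` is empty). -/
def maxValue {ι : Type*} [Fintype ι] (w : ι → ℝ) (K : Set (ι → ℝ)) : EReal :=
  ⨆ x ∈ K, ((w ⬝ᵥ x : ℝ) : EReal)

/-- `S` is a `ρ`-approximate extended formulation of the maximization problem encoded by `L`:
its optimum is at least the true one for every objective function, and at most
`ρ` times the true one for every admissible objective function. -/
def LinearEncoding.IsApproxEF {ι : Type*} [Fintype ι] (L : LinearEncoding ι) (ρ : ℝ)
    (S : ExtendedFormulation ι) : Prop :=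
  (∀ w : ι → ℝ, maxValue w L.innerPolytope ≤ maxValue w S.projection) ∧
  (∀ w ∈ L.admissible, maxValue w S.projection ≤ (ρ : EReal) * maxValue w L.innerPolytope)

/-- The 0/1 matrix `x = b bᵀ`, where `b` is the characteristic vector of the vertex set `X`. -/
def vertexSetVec {n : ℕ} (X : Finset (Fin n)) : Fin n × Fin n → ℝ :=
  fun p => if p.1 ∈ X ∧ p.2 ∈ X then 1 else 0

open Classical in
/-- The weight vector `w^G` of a graph `G` with `V(G) ⊆ [n]` (a subgraph of the complete graph on
`[n]`). -/
def cliqueWeight {n : ℕ} (G : (⊤ : SimpleGraph (Fin n)).Subgraph) : Fin n × Fin n → ℝ :=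
  fun p =>
    if p.1 = p.2 then (if p.1 ∈ G.verts then 1 else 0)
    else if p.1 ∈ G.verts ∧ p.2 ∈ G.verts ∧ ¬ G.Adj p.1 p.2 then -1 else 0

/-- The natural `n²`-dimensional linear encoding of CLIQUE. -/
def cliqueEncoding (n : ℕ) : LinearEncoding (Fin n × Fin n) where
  feasible := Set.range vertexSetVec
  zero_or_one := by
    rintro x ⟨X, rfl⟩ p
    unfold vertexSetVec
    split_ifs
    · exact Or.inr rfl
    · exact Or.inl rfl
  admissible := Set.range cliqueWeight

/-- The correlation polytope: the convex hull of the matrices `b bᵀ` with `b ∈ {0,1}^n`. -/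
def correlationPolytope (n : ℕ) : Set (Fin n × Fin n → ℝ) :=
  convexHull ℝ {x | ∃ b : Fin n → ℝ, (∀ i, b i = 0 ∨ b i = 1) ∧ ∀ i j, x (i, j) = b i * b j}

/-- The inner polytope of the encoding of CLIQUE is the correlation polytope. -/
theorem cliqueEncoding_innerPolytope (n : ℕ) :
    (cliqueEncoding n).innerPolytope = correlationPolytope n := by
  classical
  unfold LinearEncoding.innerPolytope correlationPolytope
  congr 1
  ext x
  constructor
  · rintro ⟨X, rfl⟩
    refine ⟨fun i => if i ∈ X then 1 else 0, fun i => ?_, fun i j => ?_⟩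
    · by_cases h : i ∈ X <;> simp [h]
    · by_cases hi : i ∈ X <;> by_cases hj : j ∈ X <;> simp [vertexSetVec, hi, hj]
  · rintro ⟨b, hb, hx⟩
    refine ⟨Finset.univ.filter (fun i => b i = 1), ?_⟩
    funext p
    obtain ⟨i, j⟩ := p
    rw [hx]
    rcases hb i with hi | hi <;> rcases hb j with hj | hj <;> simp [vertexSetVec, hi, hj]

end

/-! Lower bound. The edgeless graph on a vertex set `a` gives an objective `w_a` whose value at
`bbᵀ` is `1 - (|a ∩ b| - 1)²`. Its optimum over `P` is at most 1, so `w_a ⬝ x ≤ ρ` holds on the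
projection of every `ρ`-approximate system. By Farkas' lemma the slacks `ρ - w_a ⬝ z_b`, at points
`z_b` of the projection close to `bbᵀ`, form a sum of `size + 1` nonnegative rank-one matrices.
These slacks are about `ρ` on disjoint pairs and about `ρ - 1` on pairs with one common element.

Few rank-one terms cannot create this drop (`le_singlyIntersectingPairSum_mul`). Average over
bipartitions `S, Sᶜ` with `a ⊆ S`, `b ⊆ Sᶜ`: inserting `i` into both `a` and `b` alters a rank-one
term by amounts controlled by degree-one Fourier coefficients of its factors. By
`sum_abs_level_one_le` these amount to an `O(l)` fraction of the disjoint weight, up to an error of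
order `exp(-l²n/2)/l`. The relative drop `1/ρ` allows `l` of order `1/ρ`, so the size is at least
`exp(Ω(n/ρ²))` up to polynomial factors; `ρ = n^(1/2-ε)` gives the exponent `n^(2ε)`.

Upper bound. On the unit cube the diagonal contributes at most `n` and the other weights are
nonpositive, while one vertex of a nonempty graph already achieves 1. -/

/-! ### Linear programming duality -/

/-- **Farkas' lemma** for finitely many linear functionals on a real vector space. -/
theorem exists_nonneg_combination_of_nonneg_on_cone {V : Type*} [AddCommGroup V] [Module ℝ V]
    (m : ℕ) (f : Fin m → V →ₗ[ℝ] ℝ) (φ : V →ₗ[ℝ] ℝ)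
    (h : ∀ v, (∀ i, 0 ≤ f i v) → 0 ≤ φ v) :
    ∃ c : Fin m → ℝ, (∀ i, 0 ≤ c i) ∧ ∀ v, φ v = ∑ i, c i * f i v := by
  induction m generalizing φ with
  | zero =>
    refine ⟨0, fun i => i.elim0, fun v => ?_⟩
    have h1 := h v (fun i => i.elim0)
    have h2 := h (-v) (fun i => i.elim0)
    rw [map_neg] at h2
    simp only [Finset.univ_eq_empty, Finset.sum_empty]
    linarith
  | succ m ih =>
    by_cases hc : ∀ v, (∀ i : Fin m, 0 ≤ f i.succ v) → 0 ≤ φ v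
    · obtain ⟨c, hc0, hc⟩ := ih (fun i => f i.succ) φ hc
      refine ⟨Fin.cons 0 c, fun i => ?_, fun v => ?_⟩
      · refine Fin.cases ?_ (fun j => ?_) i
        · simp
        · simpa using hc0 j
      · simp [Fin.sum_univ_succ, hc v]
    -- The functional `f 0` is needed: a violating vector, rescaled to `f 0 z = -1`, defines a shear
    -- `π` onto the kernel of `f 0`, where the remaining functionals suffice.
    · push Not at hc
      obtain ⟨w, hw, hφw⟩ := hc
      have hf0 : f 0 w < 0 := by
        by_contra hcon
        push Not at hcon
        exact absurd (h w (Fin.cases hcon hw)) (not_le.mpr hφw)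
      obtain ⟨z, hz0, hz, hφz⟩ : ∃ z, f 0 z = -1 ∧ (∀ i : Fin m, 0 ≤ f i.succ z) ∧ φ z ≤ 0 := by
        refine ⟨(-(f 0 w))⁻¹ • w, ?_, fun i => ?_, ?_⟩
        · rw [map_smul, smul_eq_mul, inv_neg, neg_mul, inv_mul_cancel₀ hf0.ne]
        · rw [map_smul, smul_eq_mul]
          exact mul_nonneg (inv_nonneg.mpr (by linarith)) (hw i)
        · rw [map_smul, smul_eq_mul]
          exact mul_nonpos_of_nonneg_of_nonpos (inv_nonneg.mpr (by linarith)) hφw.le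
      let π : V →ₗ[ℝ] V := LinearMap.id + (f 0).smulRight z
      have hπ : ∀ (ψ : V →ₗ[ℝ] ℝ) v, ψ (π v) = ψ v + f 0 v * ψ z := fun ψ v => by simp [π]
      obtain ⟨c, hc0, hc⟩ := ih (fun i => (f i.succ).comp π) (φ.comp π) (fun v hv => by
        refine h (π v) (Fin.cases ?_ hv)
        rw [hπ, hz0]
        linarith)
      refine ⟨Fin.cons (∑ i, c i * f i.succ z - φ z) c, fun i => ?_, fun v => ?_⟩
      · refine Fin.cases ?_ (fun j => ?_) i
        · have : 0 ≤ ∑ i, c i * f i.succ z := Finset.sum_nonneg fun i _ => mul_nonneg (hc0 i) (hz i)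
          simpa using by linarith
        · simpa using hc0 j
      · have := hc v
        simp only [LinearMap.comp_apply, hπ, mul_add, Finset.sum_add_distrib] at this
        have h2 : ∑ i, c i * (f 0 v * f i.succ z) = f 0 v * ∑ i, c i * f i.succ z := by
          rw [Finset.mul_sum]
          exact Finset.sum_congr rfl fun i _ => by ring
        simp only [Fin.sum_univ_succ, Fin.cons_zero, Fin.cons_succ]
        rw [h2] at this
        linarith

/-- A linear inequality valid for a nonempty projection is, on all solutions of the system, a
nonnegative combination of the inequalities `y ≥ 0` and a nonnegative constant. -/
theorem ExtendedFormulation.exists_slack_eq {ι : Type*} [Fintype ι] (S : ExtendedFormulation ι)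
    (hne : S.projection.Nonempty) (w : ι → ℝ) (β : ℝ)
    (h : ∀ x ∈ S.projection, w ⬝ᵥ x ≤ β) :
    ∃ c : Fin (S.size + 1) → ℝ, (∀ i, 0 ≤ c i) ∧
      ∀ x y, S.E *ᵥ x + S.F *ᵥ y = S.g →
        β - w ⬝ᵥ x = ∑ i, c i * (Fin.cons 1 y : Fin (S.size + 1) → ℝ) i := by
  -- Homogenization: a variable `t` scales `g`, so that Farkas' lemma for cones applies to the
  -- functionals `t` and `y k` on `ker A`.
  let A : ((ι → ℝ) × (Fin S.size → ℝ) × ℝ) →ₗ[ℝ] (Fin S.numEq → ℝ) :=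
    S.E.mulVecLin ∘ₗ LinearMap.fst ℝ _ _
      + S.F.mulVecLin ∘ₗ LinearMap.fst ℝ _ _ ∘ₗ LinearMap.snd ℝ _ _
      - (LinearMap.snd ℝ _ _ ∘ₗ LinearMap.snd ℝ _ _).smulRight S.g
  have hA : ∀ x y t, A (x, y, t) = S.E *ᵥ x + S.F *ᵥ y - t • S.g := fun x y t => by simp [A]
  let V := LinearMap.ker A
  let f : Fin (S.size + 1) → V →ₗ[ℝ] ℝ :=
    Fin.cons (LinearMap.snd ℝ _ _ ∘ₗ LinearMap.snd ℝ _ _ ∘ₗ V.subtype)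
      (fun k => LinearMap.proj k ∘ₗ LinearMap.fst ℝ _ _ ∘ₗ LinearMap.snd ℝ _ _ ∘ₗ V.subtype)
  let φ : V →ₗ[ℝ] ℝ :=
    (β • (LinearMap.snd ℝ _ _ ∘ₗ LinearMap.snd ℝ _ _)
      - (dotProductBilin ℝ ℝ w) ∘ₗ LinearMap.fst ℝ _ _) ∘ₗ V.subtype
  have hφ : ∀ v : V, φ v = β * v.1.2.2 - w ⬝ᵥ v.1.1 := fun v => by
    simp [φ, dotProductBilin]
  obtain ⟨c, hc0, hc⟩ := exists_nonneg_combination_of_nonneg_on_cone (S.size + 1) f φ (by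
    rintro ⟨⟨x, y, t⟩, hv⟩ hpos
    have ht : 0 ≤ t := hpos 0
    have hy : ∀ k, 0 ≤ y k := fun k => hpos k.succ
    have hv' : S.E *ᵥ x + S.F *ᵥ y = t • S.g := by
      have := LinearMap.mem_ker.mp hv
      rw [hA] at this
      exact sub_eq_zero.mp this
    rw [hφ]
    simp only
    rcases ht.lt_or_eq with ht | rfl
    · have := h (t⁻¹ • x) ⟨t⁻¹ • y, fun k => mul_nonneg (inv_nonneg.mpr ht.le) (hy k), by
        rw [Matrix.mulVec_smul, Matrix.mulVec_smul, ← smul_add, hv', smul_smul,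
          inv_mul_cancel₀ ht.ne', one_smul]⟩
      rw [dotProduct_smul, smul_eq_mul, inv_mul_le_iff₀ ht] at this
      linarith
    -- For `t = 0` the vector `x` is a recession direction; if `w ⬝ᵥ x` were positive, moving along
    -- it from a feasible point would exceed `β`.
    · obtain ⟨x₀, y₀, hy₀, hx₀⟩ := hne
      by_contra hcon
      have hpos' : 0 < w ⬝ᵥ x := by linarith
      obtain ⟨s, hs⟩ := exists_nat_gt ((β - w ⬝ᵥ x₀) / (w ⬝ᵥ x))
      rw [div_lt_iff₀ hpos'] at hs
      have := h (x₀ + (s : ℝ) • x) ⟨y₀ + (s : ℝ) • y,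
        fun k => add_nonneg (hy₀ k) (mul_nonneg (Nat.cast_nonneg _) (hy k)), by
          rw [Matrix.mulVec_add, Matrix.mulVec_add, Matrix.mulVec_smul, Matrix.mulVec_smul,
            add_add_add_comm, ← smul_add, hv', hx₀, zero_smul, smul_zero, add_zero]⟩
      rw [dotProduct_add, dotProduct_smul, smul_eq_mul] at this
      linarith)
  refine ⟨c, hc0, fun x y hxy => ?_⟩
  have hmem : (x, y, (1 : ℝ)) ∈ V := by
    rw [LinearMap.mem_ker, hA, hxy, one_smul, sub_self]
  have := hc ⟨_, hmem⟩
  rw [hφ] at this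
  simp only [mul_one] at this
  rw [this]
  refine Finset.sum_congr rfl fun i _ => ?_
  congr 1
  refine Fin.cases ?_ (fun k => ?_) i
  · simp [f]
  · simp [f]
-- The level-one inequality
open Finset in
/-- The exponential moment of a signed sum of independent uniform signs. -/
theorem sum_powerset_exp_signed_le {α : Type*} [DecidableEq α] (S : Finset α) (σ : α → ℝ)
    (hσ : ∀ i, |σ i| = 1) (l : ℝ) :
    ∑ a ∈ S.powerset, Real.exp (l * ∑ i ∈ S, σ i * (if i ∈ a then 1 else -1))
      ≤ 2 ^ #S * Real.exp (l ^ 2 * #S / 2) := by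
  have key : ∀ a ∈ S.powerset, Real.exp (l * ∑ i ∈ S, σ i * (if i ∈ a then 1 else -1)) =
      (∏ i ∈ a, Real.exp (l * σ i)) * ∏ i ∈ S \ a, Real.exp (-(l * σ i)) := by
    intro a ha
    rw [← Real.exp_sum, ← Real.exp_sum, ← Real.exp_add, ← Finset.sum_sdiff (mem_powerset.mp ha),
      add_comm, mul_add, Finset.mul_sum, Finset.mul_sum]
    congr 2
    · exact Finset.sum_congr rfl fun i hi => by simp [hi]
    · exact Finset.sum_congr rfl fun i hi => by simp [(mem_sdiff.mp hi).2]
  rw [Finset.sum_congr rfl key, ← Finset.prod_add]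
  calc ∏ i ∈ S, (Real.exp (l * σ i) + Real.exp (-(l * σ i)))
      ≤ ∏ _i ∈ S, (2 * Real.exp (l ^ 2 / 2)) := by
        refine Finset.prod_le_prod (fun i _ => by positivity) fun i _ => ?_
        have h := Real.cosh_le_exp_half_sq (l * σ i)
        rw [Real.cosh_eq, mul_pow, ← sq_abs (σ i), hσ i] at h
        norm_num at h
        linarith
    _ = 2 ^ #S * Real.exp (l ^ 2 * #S / 2) := by
        rw [Finset.prod_const, mul_pow, ← Real.exp_nat_mul]
        congr 2
        ring

open Finset in
/-- A level-one inequality: the degree-one Fourier coefficients of a bounded nonnegative function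
on the subsets of `S` are small in comparison with its sum, up to an exponentially small error. -/
theorem sum_abs_level_one_le {α : Type*} [DecidableEq α] (S : Finset α) (u : Finset α → ℝ) (U : ℝ)
    (hu0 : ∀ a, 0 ≤ u a) (hu : ∀ a, u a ≤ U) (l : ℝ) (hl : 0 < l) (n : ℕ) (hn : #S ≤ n) :
    ∑ i ∈ S, |∑ a ∈ S.powerset, u a * (if i ∈ a then 1 else -1)|
      ≤ l * n * ∑ a ∈ S.powerset, u a + U * 2 ^ #S * (Real.exp (-(l ^ 2 * n / 2)) / l) := by
  set D : α → ℝ := fun i => ∑ a ∈ S.powerset, u a * (if i ∈ a then 1 else -1) with hD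
  set σ : α → ℝ := fun i => if 0 ≤ D i then 1 else -1 with hσ
  have hσ1 : ∀ i, |σ i| = 1 := fun i => by simp only [hσ]; split_ifs <;> simp
  have hσD : ∀ i, |D i| = σ i * D i := fun i => by
    simp only [hσ]
    split_ifs with h
    · rw [abs_of_nonneg h, one_mul]
    · rw [abs_of_neg (not_le.mp h)]; ring
  set ℓ : Finset α → ℝ := fun a => ∑ i ∈ S, σ i * (if i ∈ a then 1 else -1) with hℓ
  have hsum : ∑ i ∈ S, |D i| = ∑ a ∈ S.powerset, u a * ℓ a := by
    rw [Finset.sum_congr rfl fun i _ => hσD i]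
    simp only [hD, hℓ, Finset.mul_sum]
    rw [Finset.sum_comm]
    exact Finset.sum_congr rfl fun a _ => Finset.sum_congr rfl fun i _ => by ring
  have hU : 0 ≤ U := (hu0 ∅).trans (hu ∅)
  -- From `s ≤ exp s` at `s = l * ℓ a - l ^ 2 * n`. The shift makes the exponential moment, at most
  -- `exp (l ^ 2 * n / 2)` on average, exponentially small.
  have hpt : ∀ a ∈ S.powerset, l * (u a * ℓ a) ≤
      l ^ 2 * n * u a + U * Real.exp (-(l ^ 2 * n)) * Real.exp (l * ℓ a) := by
    intro a _
    have h1 : l * ℓ a - l ^ 2 * n ≤ Real.exp (l * ℓ a - l ^ 2 * n) := by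
      linarith [Real.add_one_le_exp (l * ℓ a - l ^ 2 * n)]
    have h2 := mul_le_mul_of_nonneg_left h1 (hu0 a)
    have h3 := mul_le_mul_of_nonneg_right (hu a) (Real.exp_pos (l * ℓ a - l ^ 2 * n)).le
    have h4 : Real.exp (l * ℓ a - l ^ 2 * n) = Real.exp (-(l ^ 2 * n)) * Real.exp (l * ℓ a) := by
      rw [← Real.exp_add]; congr 1; ring
    rw [mul_assoc U, ← h4]
    linarith
  have htot := Finset.sum_le_sum hpt
  rw [← Finset.mul_sum, Finset.sum_add_distrib, ← Finset.mul_sum, ← Finset.mul_sum] at htot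
  have hexp : Real.exp (-(l ^ 2 * n)) * ∑ a ∈ S.powerset, Real.exp (l * ℓ a) ≤
      2 ^ #S * Real.exp (-(l ^ 2 * n / 2)) := by
    calc _ ≤ Real.exp (-(l ^ 2 * n)) * (2 ^ #S * Real.exp (l ^ 2 * n / 2)) := by
          refine mul_le_mul_of_nonneg_left
            ((sum_powerset_exp_signed_le S σ hσ1 l).trans ?_) (Real.exp_pos _).le
          gcongr
      _ = _ := by
          rw [mul_left_comm, ← Real.exp_add]
          congr 2
          ring
  have hfin : l * ∑ i ∈ S, |D i| ≤
      l ^ 2 * n * ∑ a ∈ S.powerset, u a + U * (2 ^ #S * Real.exp (-(l ^ 2 * n / 2))) := by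
    rw [hsum]
    refine htot.trans ?_
    rw [mul_assoc U]
    gcongr
  have : ∑ i ∈ S, |D i| ≤
      (l ^ 2 * n * ∑ a ∈ S.powerset, u a + U * (2 ^ #S * Real.exp (-(l ^ 2 * n / 2)))) / l := by
    rw [le_div_iff₀ hl]; linarith
  refine this.trans (le_of_eq ?_)
  field_simp

/-! ### Rank-one matrices on disjoint and singly intersecting pairs -/

/-- The sum of a matrix over the pairs of disjoint sets, weighted by the number of bipartitions
that separate them. -/
noncomputable def disjointPairSum {α : Type*} [DecidableEq α] [Fintype α]
    (M : Finset α → Finset α → ℝ) : ℝ :=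
  ∑ S : Finset α, ∑ a ∈ S.powerset, ∑ b ∈ Sᶜ.powerset, M a b

/-- The sum of a matrix over the pairs of sets with exactly one common element, weighted by the
number of bipartitions of the other elements that separate them. -/
noncomputable def singlyIntersectingPairSum {α : Type*} [DecidableEq α] [Fintype α]
    (M : Finset α → Finset α → ℝ) : ℝ :=
  ∑ i : α, ∑ S ∈ (Finset.univ.erase i).powerset, ∑ a ∈ S.powerset,
    ∑ b ∈ (insert i S)ᶜ.powerset, M (insert i a) (insert i b)

-- The difference attached to `i` and `S` is the degree-one coefficient of `u` at `i` on the subsets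
-- of `insert i S`. Reindexing by that larger set reduces the claim to the level-one inequality on
-- each side of a bipartition.
open Finset in
theorem sum_level_one_mul_le {α : Type*} [DecidableEq α] [Fintype α] (u v : Finset α → ℝ) (U V : ℝ)
    (hu0 : ∀ a, 0 ≤ u a) (hu : ∀ a, u a ≤ U) (hv0 : ∀ a, 0 ≤ v a) (hv : ∀ a, v a ≤ V)
    (l : ℝ) (hl : 0 < l) :
    ∑ i : α, ∑ S ∈ (Finset.univ.erase i).powerset,
      |∑ a ∈ S.powerset, u (insert i a) - ∑ a ∈ S.powerset, u a| *
        ∑ b ∈ (insert i S)ᶜ.powerset, v b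
      ≤ l * Fintype.card α * disjointPairSum (fun a b => u a * v b)
        + U * V * 4 ^ Fintype.card α * (Real.exp (-(l ^ 2 * Fintype.card α / 2)) / l) := by
  set n := Fintype.card α
  set D : Finset α → α → ℝ := fun S i => ∑ a ∈ S.powerset, u a * (if i ∈ a then 1 else -1) with hD
  set B : Finset α → ℝ := fun S => ∑ b ∈ S.powerset, v b with hB
  have hB0 : ∀ S, 0 ≤ B S := fun S => Finset.sum_nonneg fun b _ => hv0 b
  have hBV : ∀ S, B S ≤ 2 ^ #S * V := fun S => by
    refine (Finset.sum_le_card_nsmul _ _ V fun b _ => hv b).trans (le_of_eq ?_)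
    simp
  have hU : 0 ≤ U := (hu0 ∅).trans (hu ∅)
  have hV : 0 ≤ V := (hv0 ∅).trans (hv ∅)
  have hswap : ∑ i : α, ∑ S ∈ (Finset.univ.erase i).powerset,
      |∑ a ∈ S.powerset, u (insert i a) - ∑ a ∈ S.powerset, u a| * B (insert i S)ᶜ
      = ∑ S : Finset α, ∑ i ∈ S, |D S i| * B Sᶜ := by
    have h1 : ∀ i : α, ∑ S ∈ (Finset.univ.erase i).powerset,
        |∑ a ∈ S.powerset, u (insert i a) - ∑ a ∈ S.powerset, u a| * B (insert i S)ᶜ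
        = ∑ S : Finset α, if i ∈ S then |D S i| * B Sᶜ else 0 := by
      intro i
      rw [← Finset.powerset_univ, ← Finset.insert_erase (Finset.mem_univ i),
        Finset.sum_powerset_insert (Finset.notMem_erase i _), Finset.erase_insert_eq_erase,
        Finset.erase_idem]
      rw [Finset.sum_eq_zero (s := (univ.erase i).powerset) (f := fun S =>
        if i ∈ S then |D S i| * B Sᶜ else 0), zero_add]
      · refine Finset.sum_congr rfl fun S hS => ?_
        have hiS : i ∉ S := fun h => Finset.notMem_erase i _ (mem_powerset.mp hS h)
        rw [if_pos (mem_insert_self i S)]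
        congr 2
        simp only [hD]
        rw [Finset.sum_powerset_insert hiS, add_comm, sub_eq_add_neg, ← Finset.sum_neg_distrib]
        congr 1
        · exact Finset.sum_congr rfl fun a _ => by simp
        · refine Finset.sum_congr rfl fun a ha => ?_
          rw [if_neg fun h => hiS (mem_powerset.mp ha h)]
          ring
      · intro S hS
        exact if_neg fun h => Finset.notMem_erase i _ (mem_powerset.mp hS h)
    rw [Finset.sum_congr rfl fun i _ => h1 i, Finset.sum_comm]
    refine Finset.sum_congr rfl fun S _ => ?_
    rw [Finset.sum_ite_mem, Finset.univ_inter]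
  change ∑ i : α, ∑ S ∈ (Finset.univ.erase i).powerset,
      |∑ a ∈ S.powerset, u (insert i a) - ∑ a ∈ S.powerset, u a| * B (insert i S)ᶜ ≤ _
  rw [hswap]
  have hS : ∀ S ∈ (univ : Finset (Finset α)), ∑ i ∈ S, |D S i| * B Sᶜ ≤
      l * n * (∑ a ∈ S.powerset, ∑ b ∈ Sᶜ.powerset, u a * v b)
        + U * V * 2 ^ n * (Real.exp (-(l ^ 2 * n / 2)) / l) := by
    intro S _
    have h1 := mul_le_mul_of_nonneg_right
      (sum_abs_level_one_le S u U hu0 hu l hl n (Finset.card_le_univ S)) (hB0 Sᶜ)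
    rw [Finset.sum_mul] at h1
    refine h1.trans ?_
    rw [add_mul, ← Finset.sum_mul_sum, ← mul_assoc (l * n)]
    refine add_le_add le_rfl ?_
    have h2 : (2 : ℝ) ^ n = 2 ^ #S * 2 ^ #Sᶜ := by
      rw [← pow_add, Finset.card_add_card_compl]
    have he : 0 ≤ Real.exp (-(l ^ 2 * n / 2)) / l := by positivity
    calc _ = U * 2 ^ #S * (Real.exp (-(l ^ 2 * n / 2)) / l) * B Sᶜ := rfl
      _ ≤ U * 2 ^ #S * (Real.exp (-(l ^ 2 * n / 2)) / l) * (2 ^ #Sᶜ * V) :=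
          mul_le_mul_of_nonneg_left (hBV _) (by positivity)
      _ = _ := by rw [h2]; ring
  refine (Finset.sum_le_sum hS).trans (le_of_eq ?_)
  rw [Finset.sum_add_distrib, ← Finset.mul_sum, Finset.sum_const, Finset.card_univ,
    Fintype.card_finset, nsmul_eq_mul, disjointPairSum]
  have : (4 : ℝ) ^ n = 2 ^ n * 2 ^ n := by rw [← mul_pow]; norm_num
  rw [this]
  push_cast
  ring

theorem disjointPairSum_mul_comm {α : Type*} [DecidableEq α] [Fintype α] (u v : Finset α → ℝ) :
    disjointPairSum (fun a b => v a * u b) = disjointPairSum (fun a b => u a * v b) := by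
  unfold disjointPairSum
  refine Fintype.sum_equiv (Function.Involutive.toPerm _ compl_involutive) _ _
    fun S => ?_
  simp only [Function.Involutive.coe_toPerm, compl_compl]
  rw [Finset.sum_comm]
  exact Finset.sum_congr rfl fun a _ => Finset.sum_congr rfl fun b _ => by ring

/-- Index 1 means that `i` has been inserted. The quotient by 4 averages the four products for `i`
on the left or right of the bipartition, present or absent; it equals `p₀ * q₀` when both increments
vanish, and the absolute values pay for the increments. -/
theorem sub_abs_le_mul_of_nonneg {p₀ p₁ q₀ q₁ : ℝ} (hp₀ : 0 ≤ p₀) (hp₁ : 0 ≤ p₁) (hq₀ : 0 ≤ q₀)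
    (hq₁ : 0 ≤ q₁) :
    ((p₀ + p₁) * q₀ + p₀ * (q₀ + q₁)) / 4 - 5 / 4 * (|p₁ - p₀| * q₀ + |q₁ - q₀| * p₀)
      ≤ p₁ * q₁ := by
  have h1 := mul_nonneg hp₁ hq₁
  rcases le_total p₀ p₁ with hp | hp <;> rcases le_total q₀ q₁ with hq | hq
  · rw [abs_of_nonneg (sub_nonneg.mpr hp), abs_of_nonneg (sub_nonneg.mpr hq)]
    nlinarith [mul_nonneg (sub_nonneg.mpr hp) (sub_nonneg.mpr hq),
      mul_nonneg (sub_nonneg.mpr hp) hq₀, mul_nonneg (sub_nonneg.mpr hq) hp₀]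
  · rw [abs_of_nonneg (sub_nonneg.mpr hp), abs_of_nonpos (sub_nonpos.mpr hq)]
    nlinarith [mul_nonneg (sub_nonneg.mpr hp) hq₁,
      mul_nonneg (sub_nonneg.mpr hp) hq₀, mul_nonneg (sub_nonneg.mpr hq) hp₀]
  · rw [abs_of_nonpos (sub_nonpos.mpr hp), abs_of_nonneg (sub_nonneg.mpr hq)]
    nlinarith [mul_nonneg (sub_nonneg.mpr hq) hp₁,
      mul_nonneg (sub_nonneg.mpr hp) hq₀, mul_nonneg (sub_nonneg.mpr hq) hp₀]
  · rw [abs_of_nonpos (sub_nonpos.mpr hp), abs_of_nonpos (sub_nonpos.mpr hq)]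
    nlinarith [mul_nonneg (sub_nonneg.mpr hp) (sub_nonneg.mpr hq),
      mul_nonneg (sub_nonneg.mpr hp) hq₀, mul_nonneg (sub_nonneg.mpr hq) hp₀]

open Finset in
/-- A bounded nonnegative rank-one matrix cannot weigh disjoint pairs much more than singly
intersecting pairs, up to an exponentially small error. -/
theorem le_singlyIntersectingPairSum_mul {α : Type*} [DecidableEq α] [Fintype α]
    (u v : Finset α → ℝ) (U V : ℝ)
    (hu0 : ∀ a, 0 ≤ u a) (hu : ∀ a, u a ≤ U) (hv0 : ∀ a, 0 ≤ v a) (hv : ∀ a, v a ≤ V)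
    (l : ℝ) (hl : 0 < l) :
    Fintype.card α / 4 * (1 - 10 * l) * disjointPairSum (fun a b => u a * v b)
      - 5 / 2 * (U * V * 4 ^ Fintype.card α * (Real.exp (-(l ^ 2 * Fintype.card α / 2)) / l))
      ≤ singlyIntersectingPairSum (fun a b => u a * v b) := by
  have hA := sum_level_one_mul_le u v U V hu0 hu hv0 hv l hl
  have hB := sum_level_one_mul_le v u V U hv0 hv hu0 hu l hl
  rw [disjointPairSum_mul_comm] at hB
  set Z := disjointPairSum (fun a b => u a * v b) with hZ
  set n := Fintype.card α
  have hcompl : ∀ i : α, ∀ S ∈ (univ.erase i).powerset,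
      i ∉ S ∧ i ∉ (insert i S)ᶜ ∧ Sᶜ = insert i (insert i S)ᶜ := by
    intro i S hS
    have hiS : i ∉ S := fun h => Finset.notMem_erase i _ (mem_powerset.mp hS h)
    refine ⟨hiS, by simp, ?_⟩
    ext j
    by_cases hj : j = i
    · subst hj; simp [hiS]
    · simp [hj]
  -- Complementation inside `univ.erase i` exchanges the roles of the two sides.
  have hflip : ∀ i : α, ∑ S ∈ (Finset.univ.erase i).powerset,
      |∑ b ∈ S.powerset, v (insert i b) - ∑ b ∈ S.powerset, v b| *
        ∑ a ∈ (insert i S)ᶜ.powerset, u a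
      = ∑ S ∈ (Finset.univ.erase i).powerset,
      |∑ b ∈ (insert i S)ᶜ.powerset, v (insert i b) - ∑ b ∈ (insert i S)ᶜ.powerset, v b| *
        ∑ a ∈ S.powerset, u a := by
    intro i
    have hinv : ∀ S ∈ (univ.erase i).powerset, (insert i (insert i S)ᶜ)ᶜ = S := by
      intro S hS
      rw [← (hcompl i S hS).2.2, compl_compl]
    have hmap : ∀ S ∈ (univ.erase i).powerset, (insert i S)ᶜ ∈ (univ.erase i).powerset := by
      intro S _
      rw [mem_powerset]
      intro j hj
      rw [mem_erase]
      exact ⟨fun h => by simp [h] at hj, mem_univ _⟩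
    refine Finset.sum_bij' (fun S _ => (insert i S)ᶜ) (fun S _ => (insert i S)ᶜ)
      hmap hmap hinv hinv fun S hS => ?_
    rw [hinv S hS]
  rw [Finset.sum_congr rfl fun i _ => hflip i] at hB
  -- Every bipartition of `α` arises from one of the other elements by placing `i` on the right or
  -- on the left.
  have hZi : ∀ i : α, Z = ∑ S ∈ (univ.erase i).powerset,
      ((∑ a ∈ S.powerset, u a + ∑ a ∈ S.powerset, u (insert i a)) *
          ∑ b ∈ (insert i S)ᶜ.powerset, v b
        + (∑ a ∈ S.powerset, u a) * (∑ b ∈ (insert i S)ᶜ.powerset, v b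
            + ∑ b ∈ (insert i S)ᶜ.powerset, v (insert i b))) := by
    intro i
    rw [hZ, disjointPairSum, ← Finset.powerset_univ, ← Finset.insert_erase (Finset.mem_univ i),
      Finset.sum_powerset_insert (Finset.notMem_erase i _), Finset.erase_insert_eq_erase,
      Finset.erase_idem, ← Finset.sum_add_distrib]
    refine Finset.sum_congr rfl fun S hS => ?_
    obtain ⟨h1, h2, h3⟩ := hcompl i S hS
    rw [← Finset.sum_mul_sum, ← Finset.sum_mul_sum, Finset.sum_powerset_insert h1, h3,
      Finset.sum_powerset_insert h2, add_comm]
  have hZn : (n : ℝ) * Z = ∑ i : α, ∑ S ∈ (univ.erase i).powerset,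
      ((∑ a ∈ S.powerset, u a + ∑ a ∈ S.powerset, u (insert i a)) *
          ∑ b ∈ (insert i S)ᶜ.powerset, v b
        + (∑ a ∈ S.powerset, u a) * (∑ b ∈ (insert i S)ᶜ.powerset, v b
            + ∑ b ∈ (insert i S)ᶜ.powerset, v (insert i b))) := by
    rw [← Finset.sum_congr rfl fun i _ => hZi i, Finset.sum_const, Finset.card_univ,
      nsmul_eq_mul]
  have hmain : (n : ℝ) * Z / 4 - 5 / 4 * (
      (∑ i : α, ∑ S ∈ (Finset.univ.erase i).powerset,
      |∑ a ∈ S.powerset, u (insert i a) - ∑ a ∈ S.powerset, u a| *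
        ∑ b ∈ (insert i S)ᶜ.powerset, v b) +
      ∑ i : α, ∑ S ∈ (Finset.univ.erase i).powerset,
      |∑ b ∈ (insert i S)ᶜ.powerset, v (insert i b) - ∑ b ∈ (insert i S)ᶜ.powerset, v b| *
        ∑ a ∈ S.powerset, u a)
      ≤ singlyIntersectingPairSum (fun a b => u a * v b) := by
    rw [hZn, singlyIntersectingPairSum, Finset.sum_div, ← Finset.sum_add_distrib, Finset.mul_sum,
      ← Finset.sum_sub_distrib]
    refine Finset.sum_le_sum fun i _ => ?_
    rw [Finset.sum_div, ← Finset.sum_add_distrib, Finset.mul_sum, ← Finset.sum_sub_distrib]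
    refine Finset.sum_le_sum fun S _ => ?_
    rw [← Finset.sum_mul_sum]
    exact sub_abs_le_mul_of_nonneg (Finset.sum_nonneg fun _ _ => hu0 _)
      (Finset.sum_nonneg fun _ _ => hu0 _) (Finset.sum_nonneg fun _ _ => hv0 _)
      (Finset.sum_nonneg fun _ _ => hv0 _)
  rw [mul_comm V U] at hB
  linarith

open Finset in
theorem disjointPairSum_sum {α κ : Type*} [DecidableEq α] [Fintype α] [Fintype κ]
    (f : κ → Finset α → Finset α → ℝ) :
    disjointPairSum (fun a b => ∑ k, f k a b) = ∑ k, disjointPairSum (f k) := by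
  simp only [disjointPairSum]
  symm
  rw [Finset.sum_comm]
  refine Finset.sum_congr rfl fun S _ => ?_
  rw [Finset.sum_comm]
  refine Finset.sum_congr rfl fun a _ => ?_
  rw [Finset.sum_comm]

open Finset in
theorem singlyIntersectingPairSum_sum {α κ : Type*} [DecidableEq α] [Fintype α] [Fintype κ]
    (f : κ → Finset α → Finset α → ℝ) :
    singlyIntersectingPairSum (fun a b => ∑ k, f k a b)
      = ∑ k, singlyIntersectingPairSum (f k) := by
  simp only [singlyIntersectingPairSum]
  symm
  rw [Finset.sum_comm]
  refine Finset.sum_congr rfl fun i _ => ?_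
  rw [Finset.sum_comm]
  refine Finset.sum_congr rfl fun S _ => ?_
  rw [Finset.sum_comm]
  refine Finset.sum_congr rfl fun a _ => ?_
  rw [Finset.sum_comm]

-- There are `4 ^ n` triples `(S, a, b)`, since each `S` admits `2 ^ #S * 2 ^ #Sᶜ` pairs.
open Finset in
theorem le_disjointPairSum {α : Type*} [DecidableEq α] [Fintype α] (M : Finset α → Finset α → ℝ)
    (p : ℝ) (hp : ∀ a b, Disjoint a b → p ≤ M a b) :
    4 ^ Fintype.card α * p ≤ disjointPairSum M := by
  have hS : ∀ S ∈ (univ : Finset (Finset α)),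
      2 ^ Fintype.card α * p ≤ ∑ a ∈ S.powerset, ∑ b ∈ Sᶜ.powerset, M a b := by
    intro S _
    calc 2 ^ Fintype.card α * p = ∑ _a ∈ S.powerset, ∑ _b ∈ Sᶜ.powerset, p := by
          simp only [Finset.sum_const, Finset.card_powerset, nsmul_eq_mul]
          rw [← mul_assoc, ← Finset.card_add_card_compl S, pow_add]
          push_cast
          rfl
      _ ≤ _ := Finset.sum_le_sum fun a ha => Finset.sum_le_sum fun b hb => hp a b <|
          disjoint_compl_right.mono (mem_powerset.mp ha) (mem_powerset.mp hb)
  have := Finset.card_nsmul_le_sum _ _ _ hS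
  rw [Finset.card_univ, Fintype.card_finset, nsmul_eq_mul, ← mul_assoc] at this
  refine le_trans (le_of_eq ?_) this
  push_cast
  rw [← mul_pow]
  norm_num

open Finset in
theorem singlyIntersectingPairSum_le {α : Type*} [DecidableEq α] [Fintype α]
    (M : Finset α → Finset α → ℝ) (q : ℝ) (hq : ∀ a b, #(a ∩ b) = 1 → M a b ≤ q) :
    singlyIntersectingPairSum M ≤ Fintype.card α / 4 * 4 ^ Fintype.card α * q := by
  have hi : ∀ i ∈ (univ : Finset α), ∑ S ∈ (univ.erase i).powerset, ∑ a ∈ S.powerset,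
      ∑ b ∈ (insert i S)ᶜ.powerset, M (insert i a) (insert i b)
        ≤ 4 ^ Fintype.card α / 4 * q := by
    intro i _
    have hc : #(univ.erase i) + 1 = Fintype.card α := by
      rw [Finset.card_erase_add_one (mem_univ i), Finset.card_univ]
    have hS : ∀ S ∈ (univ.erase i).powerset, ∑ a ∈ S.powerset,
        ∑ b ∈ (insert i S)ᶜ.powerset, M (insert i a) (insert i b)
          ≤ 2 ^ #(univ.erase i) * q := by
      intro S hS
      have hiS : i ∉ S := fun h => Finset.notMem_erase i _ (mem_powerset.mp hS h)
      calc _ ≤ ∑ _a ∈ S.powerset, ∑ _b ∈ (insert i S)ᶜ.powerset, q := by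
            refine Finset.sum_le_sum fun a ha => Finset.sum_le_sum fun b hb => hq _ _ ?_
            have hdis : a ∩ b = ∅ := by
              rw [← disjoint_iff_inter_eq_empty]
              exact disjoint_compl_right.mono
                ((mem_powerset.mp ha).trans (subset_insert i S)) (mem_powerset.mp hb)
            rw [← insert_inter_distrib, hdis]
            simp
        _ = _ := by
            simp only [Finset.sum_const, Finset.card_powerset, nsmul_eq_mul]
            have h1 := Finset.card_add_card_compl (insert i S)
            rw [card_insert_of_notMem hiS] at h1
            have h2 : #(univ.erase i) = #S + #(insert i S)ᶜ := by omega
            rw [← mul_assoc, h2, pow_add]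
            push_cast
            rfl
    refine (Finset.sum_le_card_nsmul _ _ _ hS).trans (le_of_eq ?_)
    rw [card_powerset, nsmul_eq_mul, ← hc, pow_succ, ← mul_assoc]
    push_cast
    rw [← mul_pow]
    norm_num
  refine (Finset.sum_le_card_nsmul _ _ _ hi).trans (le_of_eq ?_)
  rw [Finset.card_univ, nsmul_eq_mul]
  ring

/-! ### From nonnegative factorizations to the slack matrix of CLIQUE -/

/-- A lower bound on the number of terms in a nonnegative factorization of a matrix that is at
least `p` on disjoint pairs, at most `q` on singly intersecting pairs, and at most `K`
everywhere. -/
theorem nonneg_factorization_bound {α κ : Type*} [DecidableEq α] [Fintype α] [Fintype κ]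
    (M : Finset α → Finset α → ℝ) (u v : κ → Finset α → ℝ)
    (hu : ∀ k a, 0 ≤ u k a) (hv : ∀ k b, 0 ≤ v k b) (hM : ∀ a b, M a b = ∑ k, u k a * v k b)
    (p q K l : ℝ) (hp : ∀ a b, Disjoint a b → p ≤ M a b)
    (hq : ∀ a b, (a ∩ b).card = 1 → M a b ≤ q) (hK : ∀ a b, M a b ≤ K)
    (hl : 0 < l) (hl' : 10 * l ≤ 1) :
    Fintype.card α / 4 * ((1 - 10 * l) * p - q)
      ≤ 5 / 2 * (Fintype.card κ * K * (Real.exp (-(l ^ 2 * Fintype.card α / 2)) / l)) := by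
  set n := Fintype.card α
  set e := Real.exp (-(l ^ 2 * n / 2)) / l with he
  have he0 : 0 ≤ e := by positivity
  have hterm : ∀ k ∈ (Finset.univ : Finset κ),
      n / 4 * (1 - 10 * l) * disjointPairSum (fun a b => u k a * v k b)
        - 5 / 2 * (K * 4 ^ n * e) ≤ singlyIntersectingPairSum (fun a b => u k a * v k b) := by
    intro k _
    -- The product of the two maxima is itself an entry of the `k`-th term, hence at most an entry
    -- of `M`.
    obtain ⟨a, ha⟩ := Finite.exists_max (u k)
    obtain ⟨b, hb⟩ := Finite.exists_max (v k)
    have h1 := le_singlyIntersectingPairSum_mul (u k) (v k) _ _ (hu k) ha (hv k) hb l hl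
    have h2 : u k a * v k b ≤ K := by
      refine le_trans ?_ (hK a b)
      rw [hM]
      exact Finset.single_le_sum (f := fun k => u k a * v k b)
        (fun k _ => mul_nonneg (hu k a) (hv k b)) (Finset.mem_univ k)
    have h3 : u k a * v k b * 4 ^ n * e ≤ K * 4 ^ n * e := by gcongr
    linarith
  have hsum := Finset.sum_le_sum hterm
  rw [Finset.sum_sub_distrib, ← Finset.mul_sum, ← disjointPairSum_sum,
    ← singlyIntersectingPairSum_sum, Finset.sum_const, Finset.card_univ, nsmul_eq_mul] at hsum
  have hMfun : (fun a b => ∑ k, u k a * v k b) = M := by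
    funext a b; exact (hM a b).symm
  rw [hMfun] at hsum
  have h0 := le_disjointPairSum M p hp
  have h1 := singlyIntersectingPairSum_le M q hq
  have h2 : (n : ℝ) / 4 * (1 - 10 * l) * (4 ^ n * p) ≤
      n / 4 * (1 - 10 * l) * disjointPairSum M :=
    mul_le_mul_of_nonneg_left h0 (mul_nonneg (by positivity) (by linarith))
  have h4 : (0 : ℝ) < 4 ^ n := by positivity
  refine le_of_mul_le_mul_left ?_ h4
  linarith

/-- The edgeless graph with a given vertex set. -/
def edgelessSubgraph {n : ℕ} (a : Finset (Fin n)) : (⊤ : SimpleGraph (Fin n)).Subgraph where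
  verts := a
  Adj _ _ := False
  adj_sub h := h.elim
  edge_vert h := h.elim
  symm := ⟨fun _ _ h => h⟩

-- With `m = #(a ∩ b)`, the diagonal contributes `m` and the nonadjacent ordered pairs contribute
-- `-m * (m - 1)`.
open Finset in
theorem cliqueWeight_edgelessSubgraph_dotProduct {n : ℕ} (a b : Finset (Fin n)) :
    cliqueWeight (edgelessSubgraph a) ⬝ᵥ vertexSetVec b =
      2 * (#(a ∩ b) : ℝ) - (#(a ∩ b) : ℝ) ^ 2 := by
  have h : ∀ p : Fin n × Fin n, cliqueWeight (edgelessSubgraph a) p * vertexSetVec b p =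
      2 * (if p.1 = p.2 then (if p.1 ∈ a ∩ b then 1 else 0) else 0)
        - (if p.1 ∈ a ∩ b then 1 else 0) * (if p.2 ∈ a ∩ b then 1 else 0) := by
    rintro ⟨i, j⟩
    simp only [cliqueWeight, vertexSetVec, edgelessSubgraph, mem_inter, mem_coe]
    by_cases hij : i = j
    · subst hij
      by_cases h1 : i ∈ a <;> by_cases h2 : i ∈ b <;> norm_num [h1, h2]
    · by_cases h1 : i ∈ a <;> by_cases h2 : i ∈ b <;> by_cases h3 : j ∈ a <;>
        by_cases h4 : j ∈ b <;> simp [h1, h2, h3, h4, hij]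
  unfold dotProduct
  rw [Finset.sum_congr rfl fun p _ => h p, Finset.sum_sub_distrib, ← Finset.mul_sum,
    Fintype.sum_prod_type, Fintype.sum_prod_type]
  dsimp only
  rw [← Finset.sum_mul_sum univ univ (fun i => if i ∈ a ∩ b then (1 : ℝ) else 0)
    (fun j => if j ∈ a ∩ b then (1 : ℝ) else 0)]
  simp only [Finset.sum_ite_eq, Finset.mem_univ, if_true,
    Finset.sum_boole, Finset.filter_univ_mem]
  ring

theorem dotProduct_le_maxValue {ι : Type*} [Fintype ι] (w : ι → ℝ) {K : Set (ι → ℝ)} {x : ι → ℝ}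
    (hx : x ∈ K) : ((w ⬝ᵥ x : ℝ) : EReal) ≤ maxValue w K :=
  le_iSup₂ (f := fun (x : ι → ℝ) (_ : x ∈ K) => ((w ⬝ᵥ x : ℝ) : EReal)) x hx

theorem dotProduct_le_of_mem_convexHull {ι : Type*} [Fintype ι] (w : ι → ℝ) {K : Set (ι → ℝ)}
    {β : ℝ} (h : ∀ x ∈ K, w ⬝ᵥ x ≤ β) {x : ι → ℝ} (hx : x ∈ convexHull ℝ K) : w ⬝ᵥ x ≤ β := by
  have hconv : Convex ℝ {x : ι → ℝ | w ⬝ᵥ x ≤ β} :=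
    convex_halfSpace_le ⟨fun x y => dotProduct_add w x y, fun c x => dotProduct_smul c w x⟩ β
  exact convexHull_min h hconv hx

theorem maxValue_edgelessSubgraph_le {n : ℕ} (a : Finset (Fin n)) :
    maxValue (cliqueWeight (edgelessSubgraph a)) (cliqueEncoding n).innerPolytope ≤ (1 : ℝ) := by
  refine iSup₂_le fun x hx => EReal.coe_le_coe_iff.mpr (dotProduct_le_of_mem_convexHull _ ?_ hx)
  rintro _ ⟨b, rfl⟩
  rw [cliqueWeight_edgelessSubgraph_dotProduct]
  nlinarith [sq_nonneg (((a ∩ b).card : ℝ) - 1)]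

theorem ExtendedFormulation.convex_projection {ι : Type*} [Fintype ι] (S : ExtendedFormulation ι) :
    Convex ℝ S.projection := by
  rintro x ⟨y, hy, hxy⟩ x' ⟨y', hy', hxy'⟩ s t hs ht hst
  refine ⟨s • y + t • y', fun k => add_nonneg (mul_nonneg hs (hy k)) (mul_nonneg ht (hy' k)), ?_⟩
  rw [Matrix.mulVec_add, Matrix.mulVec_add, Matrix.mulVec_smul, Matrix.mulVec_smul,
    Matrix.mulVec_smul, Matrix.mulVec_smul, add_add_add_comm, ← smul_add, ← smul_add, hxy, hxy',
    ← add_smul, hst, one_smul]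

/-- A point outside the closed convex set `closure K` would be strictly separated by a functional
violating `h`. Passing to the closure avoids proving that projections are closed. -/
theorem subset_closure_of_maxValue_le {ι : Type*} [Fintype ι] {P K : Set (ι → ℝ)}
    (hK : Convex ℝ K) (h : ∀ w, maxValue w P ≤ maxValue w K) : P ⊆ closure K := by
  classical
  intro x hx
  by_contra hcon
  obtain ⟨f, c, hfc, hfx⟩ := geometric_hahn_banach_closed_point hK.closure isClosed_closure hcon
  have hf : ∀ z, f z = (fun i => f (Pi.single i 1)) ⬝ᵥ z := by
    intro z
    have := LinearMap.pi_apply_eq_sum_univ (f : (ι → ℝ) →ₗ[ℝ] ℝ) z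
    simp only [ContinuousLinearMap.coe_coe, smul_eq_mul] at this
    rw [this, dotProduct]
    refine Finset.sum_congr rfl fun i _ => ?_
    rw [mul_comm]
    congr 2
    funext j
    simp [Pi.single_apply, eq_comm]
  have h1 := (dotProduct_le_maxValue (fun i => f (Pi.single i 1)) hx).trans (h _)
  have h2 : maxValue (fun i => f (Pi.single i 1)) K ≤ (c : ℝ) := by
    refine iSup₂_le fun z hz => EReal.coe_le_coe_iff.mpr ?_
    rw [← hf]
    exact (hfc z (subset_closure hz)).le
  have h3 := EReal.coe_le_coe_iff.mp (h1.trans h2)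
  rw [← hf] at h3
  linarith

/-- The points of the inner polytope are simultaneously approximated, with respect to finitely many
objective functions, by points of the projection. -/
theorem exists_mem_projection_near {ι κ : Type*} [Fintype ι] [Finite κ] {P K : Set (ι → ℝ)}
    (hK : Convex ℝ K) (h : ∀ w, maxValue w P ≤ maxValue w K) (w : κ → ι → ℝ) (η : ℝ) (hη : 0 < η)
    {x : ι → ℝ} (hx : x ∈ P) : ∃ z ∈ K, ∀ k, |w k ⬝ᵥ z - w k ⬝ᵥ x| < η := by
  have hopen : IsOpen {z : ι → ℝ | ∀ k, |w k ⬝ᵥ z - w k ⬝ᵥ x| < η} := by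
    rw [Set.ofPred_forall]
    refine isOpen_iInter_of_finite fun k => isOpen_lt ?_ continuous_const
    unfold dotProduct
    fun_prop
  obtain ⟨z, hz, hzK⟩ := mem_closure_iff.mp (subset_closure_of_maxValue_le hK h hx) _ hopen
    (fun k => by simpa using hη)
  exact ⟨z, hzK, hz⟩

/-- A size bound for `ρ`-approximate extended formulations of CLIQUE. -/
theorem exp_le_size_of_isApproxEF {n : ℕ} (hn : 1 ≤ n) {ρ : ℝ} (hρ1 : 1 ≤ ρ) (hρn : ρ ≤ n)
    (S : ExtendedFormulation (Fin n × Fin n)) (hS : (cliqueEncoding n).IsApproxEF ρ S) :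
    Real.exp (n / ρ ^ 2 / 800) ≤ 2400 * ((S.size : ℝ) + 1) * (n : ℝ) ^ 2 := by
  have hρ0 : 0 < ρ := by linarith
  have hn1 : (1 : ℝ) ≤ n := by exact_mod_cast hn
  let w : Finset (Fin n) → Fin n × Fin n → ℝ := fun a => cliqueWeight (edgelessSubgraph a)
  have hvalid : ∀ a, ∀ x ∈ S.projection, w a ⬝ᵥ x ≤ ρ := by
    intro a x hx
    have h1 := (dotProduct_le_maxValue (w a) hx).trans (hS.2 (w a) ⟨_, rfl⟩)
    have h2 : (ρ : EReal) * maxValue (w a) (cliqueEncoding n).innerPolytope ≤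
        (ρ : EReal) * ((1 : ℝ) : EReal) :=
      mul_le_mul_of_nonneg_left (maxValue_edgelessSubgraph_le a)
        (EReal.coe_nonneg.mpr hρ0.le)
    have h3 := h1.trans h2
    rw [← EReal.coe_mul, mul_one] at h3
    exact EReal.coe_le_coe_iff.mp h3
  have hnear : ∀ b : Finset (Fin n), ∃ z ∈ S.projection,
      ∀ a, |w a ⬝ᵥ z - w a ⬝ᵥ vertexSetVec b| < 1 / 8 := fun b =>
    exists_mem_projection_near S.convex_projection hS.1 w (1 / 8) (by norm_num)
      (subset_convexHull ℝ _ ⟨b, rfl⟩)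
  choose z hz hzw using hnear
  choose y hy hzy using hz
  have hne : S.projection.Nonempty := ⟨z ∅, y ∅, hy ∅, hzy ∅⟩
  choose c hc0 hc using fun a => S.exists_slack_eq hne (w a) ρ (hvalid a)
  have hdist : ∀ a b, |w a ⬝ᵥ z b - (2 * ((a ∩ b).card : ℝ) - ((a ∩ b).card : ℝ) ^ 2)| < 1 / 8 := by
    intro a b
    rw [← cliqueWeight_edgelessSubgraph_dotProduct]
    exact hzw b a
  -- The tolerance 1/8 leaves a gap of 3/4 between the two kinds of entries. The choice `l = 1 / (20
  -- * ρ)` costs `(ρ - 1 / 8) / (2 * ρ) < 1 / 2` of it, so 1/4 survives. The extra index carries the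
  -- constant term of the slack.
  have hmain := nonneg_factorization_bound (κ := Fin (S.size + 1)) (fun a b => ρ - w a ⬝ᵥ z b)
    (fun k a => c a k) (fun k b => (Fin.cons 1 (y b) : Fin (S.size + 1) → ℝ) k)
    (fun k a => hc0 a k)
    (fun k b => by
      refine Fin.cases ?_ (fun j => ?_) k
      · simp
      · simpa using hy b j)
    (fun a b => hc a (z b) (y b) (hzy b)) (ρ - 1 / 8) (ρ - 7 / 8) (3 * (n : ℝ) ^ 2) (1 / (20 * ρ))
    (fun a b hab => by
      have := hdist a b
      rw [Finset.disjoint_iff_inter_eq_empty.mp hab, Finset.card_empty] at this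
      norm_num at this
      linarith [(abs_lt.mp this).2])
    (fun a b hab => by
      have := hdist a b
      rw [hab] at this
      norm_num at this
      linarith [(abs_lt.mp this).1])
    (fun a b => by
      have h1 := (abs_lt.mp (hdist a b)).1
      have h2 : ((a ∩ b).card : ℝ) ≤ n := by
        have := Finset.card_le_univ (a ∩ b)
        rw [Fintype.card_fin] at this
        exact_mod_cast this
      have h3 : (0 : ℝ) ≤ (a ∩ b).card := Nat.cast_nonneg _
      nlinarith)
    (by positivity)
    (by
      rw [mul_one_div, div_le_one (by positivity)]
      linarith)
  rw [Fintype.card_fin, Fintype.card_fin] at hmain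
  have hexp : -((1 / (20 * ρ)) ^ 2 * n / 2) = -(n / ρ ^ 2 / 800) := by
    field_simp
    norm_num
  rw [hexp, Real.exp_neg] at hmain
  set E := Real.exp (n / ρ ^ 2 / 800)
  have hE : 0 < E := Real.exp_pos _
  have hlow : (1 : ℝ) / 4 ≤ (1 - 10 * (1 / (20 * ρ))) * (ρ - 1 / 8) - (ρ - 7 / 8) := by
    have h1 : (1 - 10 * (1 / (20 * ρ))) * (ρ - 1 / 8) - (ρ - 7 / 8) = 1 / 4 + 1 / (16 * ρ) := by
      field_simp
      ring
    have h2 : 0 < 1 / (16 * ρ) := by positivity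
    linarith
  have h1 : (n : ℝ) / 4 * (1 / 4) ≤ 5 / 2 * (((S.size + 1 : ℕ) : ℝ) * (3 * (n : ℝ) ^ 2) *
      (E⁻¹ / (1 / (20 * ρ)))) :=
    (mul_le_mul_of_nonneg_left hlow (by positivity)).trans hmain
  have h2 : 5 / 2 * (((S.size + 1 : ℕ) : ℝ) * (3 * (n : ℝ) ^ 2) * (E⁻¹ / (1 / (20 * ρ)))) =
      150 * ((S.size : ℝ) + 1) * (n : ℝ) ^ 2 * ρ / E := by
    push_cast
    field_simp
    norm_num
  rw [h2, le_div_iff₀ hE] at h1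
  have h3 : 150 * ((S.size : ℝ) + 1) * (n : ℝ) ^ 2 * ρ ≤
      150 * ((S.size : ℝ) + 1) * (n : ℝ) ^ 2 * n := by gcongr
  have hn0 : (0 : ℝ) < n := by linarith
  refine le_of_mul_le_mul_left ?_ hn0
  linarith

/-! ### The cube as an `n`-approximation -/

/-- The unit cube is a linear-size relaxation: every coordinate lies in `[0, 1]`. -/
noncomputable def cubeFormulation (ι : Type*) [Fintype ι] [DecidableEq ι] :
    ExtendedFormulation ι where
  numEq := Fintype.card (ι ⊕ ι)
  size := Fintype.card (ι ⊕ ι)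
  E k i := Sum.elim (fun j => if j = i then 1 else 0) (fun j => if j = i then 1 else 0)
    ((Fintype.equivFin (ι ⊕ ι)).symm k)
  F := Matrix.diagonal fun k => Sum.elim (fun _ => -1) (fun _ => 1)
    ((Fintype.equivFin (ι ⊕ ι)).symm k)
  g k := Sum.elim (fun _ => 0) (fun _ => 1) ((Fintype.equivFin (ι ⊕ ι)).symm k)

theorem mem_cubeFormulation_projection {ι : Type*} [Fintype ι] [DecidableEq ι] (x : ι → ℝ) :
    x ∈ (cubeFormulation ι).projection ↔ ∀ i, 0 ≤ x i ∧ x i ≤ 1 := by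
  let e := Fintype.equivFin (ι ⊕ ι)
  -- The equations read `x i - y = 0` on the left summand and `x i + y = 1` on the right one, so the
  -- `y` are the slacks of the two bounds.
  have hE : ∀ k, ((cubeFormulation ι).E *ᵥ x) k = Sum.elim x x (e.symm k) := by
    intro k
    simp only [cubeFormulation, Matrix.mulVec, dotProduct]
    rcases (Fintype.equivFin (ι ⊕ ι)).symm k with j | j <;> simp
  have hF : ∀ (y : Fin (Fintype.card (ι ⊕ ι)) → ℝ) k, ((cubeFormulation ι).F *ᵥ y) k =
      Sum.elim (fun _ => -1) (fun _ => 1) (e.symm k) * y k := fun y k =>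
    Matrix.mulVec_diagonal _ _ _
  have hEF : ∀ (y : Fin (Fintype.card (ι ⊕ ι)) → ℝ) k,
      ((cubeFormulation ι).E *ᵥ x + (cubeFormulation ι).F *ᵥ y) k = Sum.elim x x (e.symm k) +
        Sum.elim (fun _ => -1) (fun _ => 1) (e.symm k) * y k := fun y k =>
    congrArg₂ (· + ·) (hE k) (hF y k)
  constructor
  · rintro ⟨y, hy, hxy⟩ i
    have h1 := (hEF y (e (Sum.inl i))).symm.trans (congrFun hxy (e (Sum.inl i)))
    have h2 := (hEF y (e (Sum.inr i))).symm.trans (congrFun hxy (e (Sum.inr i)))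
    simp only [cubeFormulation, e, Equiv.symm_apply_apply, Sum.elim_inl, Sum.elim_inr] at h1 h2
    have h3 := hy (Fintype.equivFin (ι ⊕ ι) (Sum.inl i))
    have h4 := hy (Fintype.equivFin (ι ⊕ ι) (Sum.inr i))
    constructor <;> linarith
  · intro hx
    refine ⟨fun k => Sum.elim x (fun i => 1 - x i) (e.symm k), fun k => ?_, ?_⟩
    · rcases h : e.symm k with j | j
      · simpa [h] using (hx j).1
      · simpa [h] using (hx j).2
    · funext k
      refine (hEF _ k).trans ?_
      change _ = Sum.elim (fun _ => (0 : ℝ)) (fun _ => 1) (e.symm k)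
      rcases e.symm k with j | j <;> simp

theorem innerPolytope_subset_cube {ι : Type*} [Fintype ι] [DecidableEq ι] (L : LinearEncoding ι) :
    L.innerPolytope ⊆ (cubeFormulation ι).projection := by
  refine convexHull_min (fun x hx => ?_) (cubeFormulation ι).convex_projection
  rw [mem_cubeFormulation_projection]
  intro i
  rcases L.zero_or_one x hx i with h | h <;> simp [h]

theorem cubeFormulation_isApproxEF (n : ℕ) :
    (cliqueEncoding n).IsApproxEF (n : ℝ) (cubeFormulation (Fin n × Fin n)) := by
  classical
  refine ⟨fun w => biSup_mono fun x hx => innerPolytope_subset_cube _ hx, ?_⟩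
  rintro _ ⟨G, rfl⟩
  have hn0 : (0 : EReal) ≤ ((n : ℝ) : EReal) := EReal.coe_nonneg.mpr (Nat.cast_nonneg n)
  have hmem : ∀ X : Finset (Fin n), vertexSetVec X ∈ (cliqueEncoding n).innerPolytope := fun X =>
    subset_convexHull ℝ _ ⟨X, rfl⟩
  by_cases hG : G.verts.Nonempty
  · obtain ⟨i, hi⟩ := hG
    have h1 : ((1 : ℝ) : EReal) ≤
        maxValue (cliqueWeight G) (cliqueEncoding n).innerPolytope := by
      refine le_trans (EReal.coe_le_coe_iff.mpr (le_of_eq ?_))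
        (dotProduct_le_maxValue (cliqueWeight G) (hmem {i}))
      rw [dotProduct, Finset.sum_eq_single (i, i)]
      · simp [cliqueWeight, vertexSetVec, hi]
      · rintro ⟨j, k⟩ _ hjk
        have : ¬ (j = i ∧ k = i) := fun h => hjk (by rw [h.1, h.2])
        simp [vertexSetVec, this]
      · simp
    have h2 : maxValue (cliqueWeight G) (cubeFormulation (Fin n × Fin n)).projection ≤
        ((n : ℝ) : EReal) := by
      refine iSup₂_le fun x hx => EReal.coe_le_coe_iff.mpr ?_
      rw [mem_cubeFormulation_projection] at hx
      have hle : ∀ p : Fin n × Fin n, cliqueWeight G p * x p ≤ if p.1 = p.2 then 1 else 0 := by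
        intro p
        have := hx p
        unfold cliqueWeight
        split_ifs <;> linarith
      refine (Finset.sum_le_sum fun p _ => hle p).trans (le_of_eq ?_)
      rw [Fintype.sum_prod_type]
      simp
    calc _ ≤ ((n : ℝ) : EReal) := h2
      _ = ((n : ℝ) : EReal) * ((1 : ℝ) : EReal) := by rw [EReal.coe_one, mul_one]
      _ ≤ _ := mul_le_mul_of_nonneg_left h1 hn0
  -- The graph without vertices has weight zero, so both optima vanish.
  · rw [Set.not_nonempty_iff_eq_empty] at hG
    have hw : cliqueWeight G = 0 := by
      funext p
      simp [cliqueWeight, hG]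
    have h1 : (0 : EReal) ≤ maxValue (cliqueWeight G) (cliqueEncoding n).innerPolytope := by
      refine le_trans (le_of_eq ?_) (dotProduct_le_maxValue (cliqueWeight G) (hmem ∅))
      rw [hw, zero_dotProduct, EReal.coe_zero]
    refine le_trans (iSup₂_le fun x _ => ?_) (mul_nonneg hn0 h1)
    rw [hw, zero_dotProduct, EReal.coe_zero]

/-! ### Asymptotics and conclusion -/

theorem eventually_mul_sq_le_exp_rpow (ε : ℝ) (hε : 0 < ε) (c A : ℝ) (hc : 0 < c) :
    ∃ N : ℕ, ∀ n : ℕ, N ≤ n → A * (n : ℝ) ^ 2 ≤ Real.exp (c * (n : ℝ) ^ (2 * ε)) := by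
  -- In terms of `x = n ^ (2 * ε)`, the square `n ^ 2` is the power `x ^ (1 / ε)`, which is
  -- negligible against `exp (c * x)`.
  have h1 := (isLittleO_rpow_exp_pos_mul_atTop (1 / ε) hc).comp_tendsto
    ((tendsto_rpow_atTop (show 0 < 2 * ε by linarith)).comp tendsto_natCast_atTop_atTop)
  have h2 := h1.bound (show (0 : ℝ) < 1 / (|A| + 1) by positivity)
  obtain ⟨N, hN⟩ := Filter.eventually_atTop.mp h2
  refine ⟨N, fun n hn => ?_⟩
  have h3 := hN n hn
  simp only [Function.comp_apply, Real.norm_eq_abs, Real.abs_exp] at h3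
  rw [← Real.rpow_mul (Nat.cast_nonneg n), show 2 * ε * (1 / ε) = (2 : ℕ) by
    field_simp; norm_num, Real.rpow_natCast, abs_of_nonneg (sq_nonneg _), one_div,
    inv_mul_eq_div, le_div_iff₀ (by positivity)] at h3
  refine le_trans ?_ h3
  nlinarith [sq_nonneg (n : ℝ), le_abs_self A]

theorem theorem5 :
    (∃ C : ℝ, ∀ n : ℕ, 1 ≤ n → ∃ S : ExtendedFormulation (Fin n × Fin n),
      (cliqueEncoding n).IsApproxEF (n : ℝ) S ∧ (S.size : ℝ) ≤ C * (n : ℝ) ^ 2) ∧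
    (∀ ε : ℝ, 0 < ε → ε < 1 / 2 → ∃ c : ℝ, 0 < c ∧ ∃ N : ℕ, ∀ n : ℕ, N ≤ n →
      ∀ S : ExtendedFormulation (Fin n × Fin n),
        (cliqueEncoding n).IsApproxEF ((n : ℝ) ^ (1 / 2 - ε)) S →
          (2 : ℝ) ^ (c * (n : ℝ) ^ (2 * ε)) ≤ (S.size : ℝ)) := by
  refine ⟨⟨2, fun n _ => ⟨_, cubeFormulation_isApproxEF n, le_of_eq ?_⟩⟩, fun ε hε hε' => ?_⟩
  · simp only [cubeFormulation, Fintype.card_sum, Fintype.card_prod, Fintype.card_fin]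
    push_cast
    ring
  obtain ⟨N, hN⟩ := eventually_mul_sq_le_exp_rpow ε hε (1 / 1600) 4800 (by norm_num)
  -- Half of the exponent `t / 800` absorbs the factor `4800 * n ^ 2`, leaving `1 / 1600`. The
  -- resulting `2 * X ≤ size + 1` gives `X ≤ size` because `X ≥ 1`.
  refine ⟨1 / 1600, by norm_num, max N 1, fun n hn S hS => ?_⟩
  have hn1 : 1 ≤ n := (le_max_right _ _).trans hn
  have hn1' : (1 : ℝ) ≤ n := by exact_mod_cast hn1
  have hn0 : (0 : ℝ) < n := by linarith
  have hlarge := hN n ((le_max_left _ _).trans hn)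
  have hbound := exp_le_size_of_isApproxEF hn1
    (Real.one_le_rpow hn1' (by linarith))
    (by simpa using Real.rpow_le_rpow_of_exponent_le hn1' (show 1 / 2 - ε ≤ 1 by linarith)) S hS
  have hy : (n : ℝ) / ((n : ℝ) ^ (1 / 2 - ε)) ^ 2 = (n : ℝ) ^ (2 * ε) := by
    rw [← Real.rpow_natCast, ← Real.rpow_mul hn0.le]
    nth_rewrite 1 [← Real.rpow_one (n : ℝ)]
    rw [← Real.rpow_sub hn0]
    congr 1
    push_cast
    ring
  rw [hy] at hbound
  set t := (n : ℝ) ^ (2 * ε) with ht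
  have ht0 : 0 ≤ t := by positivity
  set X := Real.exp (1 / 1600 * t) with hX
  have hX1 : 1 ≤ X := Real.one_le_exp (by positivity)
  have hXX : Real.exp (t / 800) = X * X := by
    rw [hX, ← Real.exp_add]
    congr 1
    ring
  rw [hXX] at hbound
  have h1 : 4800 * (n : ℝ) ^ 2 * X ≤ X * X := mul_le_mul_of_nonneg_right hlarge (by linarith)
  have h2 : 2 * X ≤ (S.size : ℝ) + 1 := by
    refine le_of_mul_le_mul_left ?_ (show (0 : ℝ) < 2400 * (n : ℝ) ^ 2 by positivity)
    linarith
  have h3 : (2 : ℝ) ^ (1 / 1600 * t) ≤ X := by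
    rw [hX, Real.rpow_def_of_pos (by norm_num)]
    refine Real.exp_le_exp.mpr ?_
    have := Real.log_two_lt_d9
    nlinarith
  linarith
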